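/- Let $d\ge 1$. For a Lebesgue measurable set $E\subset\mathbb{R}^d$ let $$P(E)=\sup\Big\{-\int_E \operatorname{div}\xi\,dx \;:\; \xi\in C_c^1(\mathbb{R}^d;\mathbb{R}^d),\ \sup|\xi|\le 1\Big\}\in[0,\infty]$$ denote its perimeter, and say that $E$ has finite perimeter if $P(E)<\infty$. For Lebesgue measurable sets $E,F\subset\mathbb{R}^d$ of finite volume let $$W_1(\chi_E,\chi_F)=\inf_\gamma \iint |x-y|\,d\gamma(x,y)\in[0,\infty],$$ where the infimum runs over all measures $\gamma$ on $\mathbb{R}^d\times\mathbb{R}^d$ with marginals $\chi_E(x)\,dx$ and $\chi_F(y)\,dy$; in particular $W_1(\chi_E,\chi_F)=+\infty$ if $|E|\neq|F|$. There is a constant $C<\infty$, depending only on $d$, such that for all sets $E,F\subset\mathbb{R}^d$ of finite perimeter with $\int_{E\cup F}|x|\,dx<\infty$ (which forces $|E|,|F|<\infty$), $$|E\triangle F|\le C\,\sqrt{P(E)+P(F)}\,\sqrt{W_1(\chi_E,\chi_F)}$$ (with the convention $0\cdot\infty=0$ on the right-hand side). -/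

import Mathlib

open MeasureTheory

open scoped ENNReal NNReal symmDiff

noncomputable section

/-- The divergence `∑ i, ∂ᵢ ξᵢ` of a vector field on `ℝ^d`. -/
def divergence {d : ℕ} (ξ : EuclideanSpace ℝ (Fin d) → EuclideanSpace ℝ (Fin d))
    (x : EuclideanSpace ℝ (Fin d)) : ℝ :=
  ∑ i : Fin d, (fderiv ℝ ξ x (EuclideanSpace.single i 1)) i

/-- The perimeter `P(E) = sup { -∫_E div ξ dx : ξ ∈ C_c^1(ℝ^d; ℝ^d), sup |ξ| ≤ 1 }` in `[0, ∞]`.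
Since `ξ = 0` is admissible the supremum is nonnegative, so truncating negative values by
`ENNReal.ofReal` does not change it. -/
def perimeter {d : ℕ} (E : Set (EuclideanSpace ℝ (Fin d))) : ℝ≥0∞ :=
  ⨆ (ξ : EuclideanSpace ℝ (Fin d) → EuclideanSpace ℝ (Fin d))
    (_ : ContDiff ℝ 1 ξ) (_ : HasCompactSupport ξ) (_ : ∀ x, ‖ξ x‖ ≤ 1),
    ENNReal.ofReal (-∫ x in E, divergence ξ x)

/-- `E` has finite perimeter: it is Lebesgue measurable and `P(E) < ∞`. -/
def HasFinitePerimeter {d : ℕ} (E : Set (EuclideanSpace ℝ (Fin d))) : Prop :=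
  NullMeasurableSet E volume ∧ perimeter E < ∞

/-- `γ` is a transport plan between `μ` and `ν`: its marginals are `μ` and `ν`. -/
def IsTransportPlan {X : Type*} [MeasurableSpace X] (μ ν : Measure X)
    (γ : Measure (X × X)) : Prop :=
  γ.map Prod.fst = μ ∧ γ.map Prod.snd = ν

/-- The `1`-Wasserstein distance `inf ∬ |x - y| dγ(x, y)` over all transport plans `γ` between
`μ` and `ν`. It is `∞` if there is none, that is, if finite measures `μ`, `ν` differ in mass. -/
def wassersteinOne {X : Type*} [MeasurableSpace X] [PseudoEMetricSpace X]
    (μ ν : Measure X) : ℝ≥0∞ :=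
  ⨅ (γ : Measure (X × X)) (_ : IsTransportPlan μ ν γ), ∫⁻ p, edist p.1 p.2 ∂γ

end

/-! Functions `η` of class `C_c¹` with values in `[-1, 1]` approximate `χ_E - χ_F` in `L¹`, so it
suffices to bound `∫_E η - ∫_F η`. Replace `η` by an average over translates of length at most `r`.
By the definition of the perimeter this costs at most `r (P(E) + P(F))`. The averaged function is
Lipschitz with constant `L / r`, where `L` is the `L¹` norm of the gradient of the averaging kernel,
so its integrals over `E` and `F` differ by at most `(L / r) W₁(χ_E, χ_F)`. The choice
`r = √W₁ / √(P(E) + P(F))` balances the two terms.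

No such `r` is available if `W₁` or `P(E) + P(F)` vanishes, but then `E ∆ F` is a null set. In the
first case this is because the test functions are themselves Lipschitz. In the second, `∫_E η` does
not change when `η` is translated, and it tends to `0` as the translates of `η` escape to
infinity. -/

theorem le_mul_sqrt_mul_sqrt_of_forall_le {v p w L : ℝ} (hp : 0 < p) (hw : 0 < w)
    (h : ∀ r > 0, v ≤ r * p + L / r * w) : v ≤ (1 + L) * √p * √w := by
  have hp' := Real.sqrt_pos.2 hp
  have hw' := Real.sqrt_pos.2 hw
  calc v ≤ √w / √p * p + L / (√w / √p) * w := h _ (div_pos hw' hp')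
    _ = √w / √p * √p ^ 2 + L / (√w / √p) * √w ^ 2 := by rw [Real.sq_sqrt hp.le, Real.sq_sqrt hw.le]
    _ = (1 + L) * √p * √w := by field_simp

theorem le_mul_rpow_half_mul_rpow_half {v p w : ℝ≥0∞} {L : ℝ≥0} (hv : v ≠ ∞)
    (hp0 : p = 0 → v = 0) (hw0 : w = 0 → v = 0)
    (h : p ≠ ∞ → w ≠ ∞ → ∀ r : ℝ, 0 < r → v.toReal ≤ r * p.toReal + L / r * w.toReal) :
    v ≤ (1 + L : ℝ≥0) * p ^ (1 / 2 : ℝ) * w ^ (1 / 2 : ℝ) := by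
  rcases eq_or_ne p 0 with hp | hp
  · simp [hp0 hp]
  rcases eq_or_ne w 0 with hw | hw
  · simp [hw0 hw]
  rcases eq_or_ne p ∞ with rfl | hp'
  · simp [ENNReal.mul_top, ENNReal.top_mul, hw]
  rcases eq_or_ne w ∞ with rfl | hw'
  · simp [ENNReal.mul_top, hp, hp']
  have hreal := le_mul_sqrt_mul_sqrt_of_forall_le (ENNReal.toReal_pos hp hp')
    (ENNReal.toReal_pos hw hw') (h hp' hw')
  rw [← ENNReal.toReal_le_toReal hv (by finiteness), ENNReal.toReal_mul, ENNReal.toReal_mul,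
    ← ENNReal.toReal_rpow, ← ENNReal.toReal_rpow, ← Real.sqrt_eq_rpow, ← Real.sqrt_eq_rpow,
    ENNReal.coe_toReal, NNReal.coe_add, NNReal.coe_one]
  exact hreal

theorem measure_lt_top_of_setLIntegral_enorm_lt_top {V : Type*} [NormedAddCommGroup V]
    [ProperSpace V] [MeasurableSpace V] [OpensMeasurableSpace V] {μ : Measure V}
    [IsFiniteMeasureOnCompacts μ] {S : Set V} (h : ∫⁻ x in S, ‖x‖ₑ ∂μ < ∞) : μ S < ∞ := by
  have hfar : μ.restrict S {x | 1 ≤ ‖x‖ₑ} ≤ ∫⁻ x in S, ‖x‖ₑ ∂μ := by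
    simpa using mul_meas_ge_le_lintegral (μ := μ.restrict S) measurable_enorm 1
  have hcover : Set.univ ⊆ {x : V | 1 ≤ ‖x‖ₑ} ∪ Metric.closedBall 0 1 := fun x _ =>
    (le_total 1 ‖x‖ₑ).imp_right fun hx => by simpa [← ofReal_norm] using hx
  calc μ S = μ.restrict S Set.univ := (Measure.restrict_apply_univ S).symm
    _ ≤ μ.restrict S {x | 1 ≤ ‖x‖ₑ} + μ.restrict S (Metric.closedBall 0 1) :=
        (measure_mono hcover).trans (measure_union_le _ _)
    _ ≤ (∫⁻ x in S, ‖x‖ₑ ∂μ) + μ (Metric.closedBall 0 1) :=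
        add_le_add hfar (Measure.restrict_apply_le _ _)
    _ < ∞ := ENNReal.add_lt_top.2 ⟨h, (isCompact_closedBall 0 1).measure_lt_top⟩

theorem tendsto_integral_comp_add_smul_atTop {V : Type*} [NormedAddCommGroup V] [NormedSpace ℝ V]
    [MeasurableSpace V] [BorelSpace V] {μ : Measure V} [IsFiniteMeasure μ] {η : V → ℝ}
    (hη : Continuous η) {B : ℝ} (hB : ∀ x, ‖η x‖ ≤ B)
    (hη0 : Filter.Tendsto η (Filter.cocompact V) (nhds 0)) {e : V} (he : e ≠ 0) :
    Filter.Tendsto (fun t : ℝ => ∫ x, η (x + t • e) ∂μ) Filter.atTop (nhds 0) := by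
  rw [← integral_zero V ℝ (μ := μ)]
  refine tendsto_integral_filter_of_dominated_convergence (fun _ => B)
    (.of_forall fun t => (hη.comp (by fun_prop)).aestronglyMeasurable)
    (.of_forall fun t => ae_of_all _ fun x => hB _) (integrable_const B) (ae_of_all _ fun x => ?_)
  refine hη0.comp (tendsto_cocompact_of_tendsto_dist_comp_atTop x ?_)
  simpa [dist_eq_norm, norm_smul] using
    Filter.tendsto_abs_atTop_atTop.atTop_mul_const (norm_pos_iff.2 he)

theorem measureReal_symmDiff_eq_integral {α : Type*} [MeasurableSpace α] {μ : Measure α}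
    {E F : Set α} (hE : NullMeasurableSet E μ) (hF : NullMeasurableSet F μ) :
    μ.real (E ∆ F) = ∫ x, (E.indicator 1 x - F.indicator 1 x : ℝ) ^ 2 ∂μ := by
  have hEF : NullMeasurableSet (E ∆ F) μ := (hE.diff hF).union (hF.diff hE)
  rw [← setIntegral_one_eq_measureReal, ← integral_indicator₀ hEF]
  congr with x
  by_cases hxE : x ∈ E <;> by_cases hxF : x ∈ F <;> simp [Set.mem_symmDiff, hxE, hxF]

section TestFunctions

variable {V : Type*} [NormedAddCommGroup V] [NormedSpace ℝ V]

/-- Test functions against which total variation can be computed: `C¹`, compactly supported and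
bounded by `1` in absolute value. Multiplied by a unit vector, they are admissible vector fields in
the definition of `perimeter`. -/
structure IsUnitTestFunction (η : V → ℝ) : Prop where
  contDiff : ContDiff ℝ 1 η
  hasCompactSupport : HasCompactSupport η
  norm_le_one : ∀ x, ‖η x‖ ≤ 1

namespace IsUnitTestFunction

variable {η : V → ℝ}

theorem continuous (hη : IsUnitTestFunction η) : Continuous η :=
  hη.contDiff.continuous

theorem neg (hη : IsUnitTestFunction η) : IsUnitTestFunction fun x => -η x where
  contDiff := hη.contDiff.neg
  hasCompactSupport := hη.hasCompactSupport.neg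
  norm_le_one x := (norm_neg (η x)).trans_le (hη.norm_le_one x)

theorem comp_add_right (hη : IsUnitTestFunction η) (v : V) :
    IsUnitTestFunction fun x => η (x + v) where
  contDiff := hη.contDiff.comp (contDiff_id.add contDiff_const)
  hasCompactSupport := hη.hasCompactSupport.comp_homeomorph (Homeomorph.addRight v)
  norm_le_one x := hη.norm_le_one (x + v)

theorem integrable [MeasurableSpace V] [OpensMeasurableSpace V] {μ : Measure V}
    [IsFiniteMeasureOnCompacts μ] (hη : IsUnitTestFunction η) : Integrable η μ :=
  hη.continuous.integrable_of_hasCompactSupport hη.hasCompactSupport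

end IsUnitTestFunction

-- `t ↦ sin (π t / 2)` is a smooth truncation to `[-1, 1]` that fixes `-1`, `0` and `1`.
theorem exists_isUnitTestFunction_integral_abs_sub_le [FiniteDimensional ℝ V] [MeasurableSpace V]
    [BorelSpace V] {μ : Measure V} [IsFiniteMeasureOnCompacts μ] {g : V → ℝ}
    (hg : Integrable g μ) (hvalues : ∀ x, g x = 0 ∨ g x = 1 ∨ g x = -1) {ε : ℝ} (hε : 0 < ε) :
    ∃ η, IsUnitTestFunction η ∧ ∫ x, |η x - g x| ∂μ ≤ ε := by
  obtain ⟨φ, hφc, hφ, hgφ⟩ := (memLp_one_iff_integrable.2 hg).exist_eLpNorm_sub_le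
    ENNReal.one_ne_top le_rfl (ε := ε / (Real.pi / 2)) (by positivity)
  have hφI : Integrable φ μ := hφ.continuous.integrable_of_hasCompactSupport hφc
  have hgφ' : ∫ x, |g x - φ x| ∂μ ≤ ε / (Real.pi / 2) := by
    rw [eLpNorm_one_eq_lintegral_enorm, ← ofReal_integral_norm_eq_lintegral_enorm (hg.sub hφI),
      ENNReal.ofReal_le_ofReal_iff (by positivity)] at hgφ
    exact hgφ
  have hη : IsUnitTestFunction fun x => Real.sin (Real.pi / 2 * φ x) :=
    { contDiff := Real.contDiff_sin.comp (contDiff_const.mul (hφ.of_le (by simp)))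
      hasCompactSupport := hφc.comp_left (g := fun t => Real.sin (Real.pi / 2 * t)) (by simp)
      norm_le_one := fun x => Real.abs_sin_le_one _ }
  refine ⟨_, hη, ?_⟩
  have hfix : ∀ x, g x = Real.sin (Real.pi / 2 * g x) := fun x => by
    rcases hvalues x with h | h | h <;> simp [h]
  calc ∫ x, |Real.sin (Real.pi / 2 * φ x) - g x| ∂μ
      ≤ ∫ x, Real.pi / 2 * |g x - φ x| ∂μ := by
        refine integral_mono (hη.integrable.sub hg).abs ((hg.sub hφI).abs.const_mul _) fun x => ?_
        calc |Real.sin (Real.pi / 2 * φ x) - g x|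
            = |Real.sin (Real.pi / 2 * φ x) - Real.sin (Real.pi / 2 * g x)| := by rw [← hfix]
          _ ≤ |Real.pi / 2 * φ x - Real.pi / 2 * g x| := Real.abs_sin_sub_sin_le _ _
          _ = Real.pi / 2 * |g x - φ x| := by
              rw [← mul_sub, abs_mul, abs_of_pos (by positivity), abs_sub_comm]
    _ = Real.pi / 2 * ∫ x, |g x - φ x| ∂μ := integral_const_mul _ _
    _ ≤ ε := by rwa [← le_div_iff₀' (by positivity)]

theorem measureReal_symmDiff_le_of_forall_isUnitTestFunction
    [FiniteDimensional ℝ V] [MeasurableSpace V] [BorelSpace V] {μ : Measure V}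
    [IsFiniteMeasureOnCompacts μ] {E F : Set V} (hE : NullMeasurableSet E μ)
    (hF : NullMeasurableSet F μ) (hEv : μ E ≠ ∞) (hFv : μ F ≠ ∞) {M : ℝ}
    (hM : ∀ η : V → ℝ, IsUnitTestFunction η → ∫ x in E, η x ∂μ - ∫ x in F, η x ∂μ ≤ M) :
    μ.real (E ∆ F) ≤ M := by
  refine le_of_forall_pos_le_add fun ε hε => ?_
  set g : V → ℝ := fun x => E.indicator 1 x - F.indicator 1 x
  have hvalues : ∀ x, g x = 0 ∨ g x = 1 ∨ g x = -1 := fun x => by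
    by_cases hxE : x ∈ E <;> by_cases hxF : x ∈ F <;> simp [g, hxE, hxF]
  have hgle : ∀ x, |g x| ≤ 1 := fun x => by rcases hvalues x with h | h | h <;> simp [h]
  have hg : Integrable g μ := ((integrableOn_const hEv).integrable_indicator₀ hE).sub
    ((integrableOn_const hFv).integrable_indicator₀ hF)
  obtain ⟨η, hη, hηg⟩ := exists_isUnitTestFunction_integral_abs_sub_le hg hvalues hε
  have hgη : ∫ x, g x * η x ∂μ = ∫ x in E, η x ∂μ - ∫ x in F, η x ∂μ := by
    rw [← integral_indicator₀ hE, ← integral_indicator₀ hF,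
      ← integral_sub (hη.integrable.indicator₀ hE) (hη.integrable.indicator₀ hF)]
    congr with x
    by_cases hxE : x ∈ E <;> by_cases hxF : x ∈ F <;> simp [g, hxE, hxF]
  have hgηI : Integrable (fun x => g x * η x) μ :=
    hg.mul_bdd hη.continuous.aestronglyMeasurable (ae_of_all _ hη.norm_le_one)
  have hηgI : Integrable (fun x => |η x - g x|) μ := (hη.integrable.sub hg).abs
  calc μ.real (E ∆ F) = ∫ x, g x ^ 2 ∂μ := measureReal_symmDiff_eq_integral hE hF
    _ ≤ ∫ x, (g x * η x + |η x - g x|) ∂μ := by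
        refine integral_mono_of_nonneg (ae_of_all _ fun x => sq_nonneg _)
          (hgηI.add hηgI) (ae_of_all _ fun x => ?_)
        have : g x * (g x - η x) ≤ |η x - g x| := by
          rw [abs_sub_comm]
          refine (le_abs_self _).trans ?_
          rw [abs_mul]
          exact mul_le_of_le_one_left (abs_nonneg _) (hgle x)
        linear_combination this
    _ ≤ M + ε := by
        rw [integral_add hgηI hηgI, hgη]
        exact add_le_add (hM η hη) hηg

end TestFunctions

section Averages

variable {V : Type*} [NormedAddCommGroup V] [NormedSpace ℝ V]

theorem sub_eq_integral_fderiv {G : Type*} [NormedAddCommGroup G] [NormedSpace ℝ G]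
    [CompleteSpace G] {f : V → G} (hf : ContDiff ℝ 1 f) (x h : V) :
    f (x + h) - f x = ∫ t in (0 : ℝ)..1, fderiv ℝ f (x + t • h) h := by
  have hderiv : ∀ t : ℝ, HasDerivAt (fun t : ℝ => f (x + t • h)) (fderiv ℝ f (x + t • h) h) t := by
    intro t
    have hline : HasDerivAt (fun t : ℝ => x + t • h) h t := by
      simpa using ((hasDerivAt_id t).smul_const h).const_add x
    exact (hf.differentiable one_ne_zero _).hasFDerivAt.comp_hasDerivAt t hline
  have hcont : Continuous fun t : ℝ => fderiv ℝ f (x + t • h) h :=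
    ((hf.continuous_fderiv one_ne_zero).comp (by fun_prop)).clm_apply continuous_const
  rw [intervalIntegral.integral_eq_sub_of_hasDerivAt (fun t _ => hderiv t)
    (hcont.intervalIntegrable 0 1)]
  simp

theorem enorm_sub_le_lintegral_enorm_fderiv {G : Type*} [NormedAddCommGroup G] [NormedSpace ℝ G]
    [CompleteSpace G] {f : V → G} (hf : ContDiff ℝ 1 f) (x h : V) :
    ‖f (x + h) - f x‖ₑ ≤ ‖h‖ₑ * ∫⁻ t in Set.Ioc (0 : ℝ) 1, ‖fderiv ℝ f (x + t • h)‖ₑ := by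
  rw [sub_eq_integral_fderiv hf, intervalIntegral.integral_of_le zero_le_one,
    ← lintegral_const_mul' _ _ enorm_ne_top]
  refine (enorm_integral_le_lintegral_enorm _).trans (lintegral_mono fun t => ?_)
  rw [mul_comm]
  exact ContinuousLinearMap.le_opENorm _ _

variable [MeasurableSpace V]

theorem lintegral_enorm_comp_add_sub_le [BorelSpace V] {G : Type*} [NormedAddCommGroup G]
    [NormedSpace ℝ G] [CompleteSpace G] {μ : Measure V} [SFinite μ]
    [μ.IsAddRightInvariant] {f : V → G} (hf : ContDiff ℝ 1 f) (h : V) :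
    ∫⁻ x, ‖f (x + h) - f x‖ₑ ∂μ ≤ ‖h‖ₑ * ∫⁻ x, ‖fderiv ℝ f x‖ₑ ∂μ := by
  have hmeas : Measurable fun p : V × ℝ => ‖fderiv ℝ f (p.1 + p.2 • h)‖ₑ :=
    ((hf.continuous_fderiv one_ne_zero).comp (by fun_prop)).enorm.measurable
  calc ∫⁻ x, ‖f (x + h) - f x‖ₑ ∂μ
      ≤ ∫⁻ x, ‖h‖ₑ * (∫⁻ t in Set.Ioc (0 : ℝ) 1, ‖fderiv ℝ f (x + t • h)‖ₑ) ∂μ :=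
        lintegral_mono fun x => enorm_sub_le_lintegral_enorm_fderiv hf x h
    _ = ‖h‖ₑ * ∫⁻ t in Set.Ioc (0 : ℝ) 1, ∫⁻ x, ‖fderiv ℝ f (x + t • h)‖ₑ ∂μ := by
        rw [lintegral_const_mul' _ _ enorm_ne_top, lintegral_lintegral_swap hmeas.aemeasurable]
    _ = ‖h‖ₑ * ∫⁻ x, ‖fderiv ℝ f x‖ₑ ∂μ := by
        simp [lintegral_add_right_eq_self fun x => ‖fderiv ℝ f x‖ₑ]

/-- The average of `η` over translates of the argument by `r • z`, with density `k` in `z`. It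
replaces a mollification of `η` at scale `r`. -/
noncomputable def kernelAverage (μ : Measure V) (k η : V → ℝ) (r : ℝ) (x : V) : ℝ :=
  ∫ z, k z * η (x + r • z) ∂μ

theorem kernelAverage_neg (μ : Measure V) (k η : V → ℝ) (r : ℝ) (x : V) :
    kernelAverage μ k (fun y => -η y) r x = -kernelAverage μ k η r x := by
  simp only [kernelAverage, mul_neg, integral_neg]

theorem kernelAverage_add [MeasurableAdd V] {μ : Measure V} [μ.IsAddRightInvariant]
    (k η : V → ℝ) {r : ℝ} (hr : r ≠ 0) (x v : V) :
    kernelAverage μ k η r (x + v) = ∫ z, k (z + -(r⁻¹ • v)) * η (x + r • z) ∂μ := by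
  rw [kernelAverage, ← integral_add_right_eq_self _ (-(r⁻¹ • v))]
  congr with z
  rw [smul_add, smul_neg, smul_inv_smul₀ hr, add_assoc, add_comm v, neg_add_cancel_right]

/-- A `C¹` probability density with respect to `μ`, supported in the closed unit ball, to be used as
the weight of a `kernelAverage`. -/
structure IsAveragingKernel (μ : Measure V) (k : V → ℝ) : Prop where
  contDiff : ContDiff ℝ 1 k
  nonneg : ∀ z, 0 ≤ k z
  support_subset : Function.support k ⊆ Metric.closedBall 0 1
  integral_eq_one : ∫ z, k z ∂μ = 1

theorem exists_isAveragingKernel [BorelSpace V] [FiniteDimensional ℝ V] (μ : Measure V)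
    [IsLocallyFiniteMeasure μ] [μ.IsOpenPosMeasure] : ∃ k, IsAveragingKernel μ k := by
  let b : ContDiffBump (0 : V) := ⟨1 / 2, 1, by norm_num, by norm_num⟩
  exact ⟨b.normed μ,
    { contDiff := b.contDiff_normed
      nonneg := b.nonneg_normed
      support_subset := b.support_normed_eq.trans_subset Metric.ball_subset_closedBall
      integral_eq_one := b.integral_normed }⟩

namespace IsAveragingKernel

variable {μ : Measure V} {k η : V → ℝ}

theorem integrable (hk : IsAveragingKernel μ k) : Integrable k μ :=
  not_imp_comm.1 integral_undef (hk.integral_eq_one.trans_ne one_ne_zero)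

theorem norm_kernelAverage_le_one (hk : IsAveragingKernel μ k) (hη1 : ∀ x, ‖η x‖ ≤ 1)
    (r : ℝ) (x : V) : ‖kernelAverage μ k η r x‖ ≤ 1 := by
  rw [← hk.integral_eq_one]
  refine norm_integral_le_of_norm_le hk.integrable (ae_of_all _ fun z => ?_)
  rw [norm_mul, Real.norm_of_nonneg (hk.nonneg z)]
  exact mul_le_of_le_one_right (hk.nonneg z) (hη1 _)

variable [BorelSpace V]

theorem lintegral_enorm_fderiv_ne_top [FiniteDimensional ℝ V] [IsFiniteMeasureOnCompacts μ]
    (hk : IsAveragingKernel μ k) : ∫⁻ z, ‖fderiv ℝ k z‖ₑ ∂μ ≠ ∞ := by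
  have := FiniteDimensional.proper ℝ V
  have hsupp : HasCompactSupport k :=
    .of_support_subset_isCompact (isCompact_closedBall 0 1) hk.support_subset
  exact ((hk.contDiff.continuous_fderiv one_ne_zero).integrable_of_hasCompactSupport
    (hsupp.fderiv ℝ)).2.ne

variable [SFinite μ] [μ.IsAddRightInvariant]

-- Changing variables moves the increment from `η`, whose derivative is not controlled, to `k`.
theorem enorm_kernelAverage_add_sub_le (hk : IsAveragingKernel μ k) (hη : Continuous η)
    (hη1 : ∀ x, ‖η x‖ ≤ 1) {r : ℝ} (hr : 0 < r) (x v : V) :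
    ‖kernelAverage μ k η r (x + v) - kernelAverage μ k η r x‖ₑ ≤
      (∫⁻ z, ‖fderiv ℝ k z‖ₑ ∂μ) / ENNReal.ofReal r * ‖v‖ₑ := by
  have hbdd : ∀ {f : V → ℝ}, Integrable f μ → Integrable (fun z => f z * η (x + r • z)) μ :=
    fun hf => hf.mul_bdd (hη.comp (by fun_prop)).aestronglyMeasurable (ae_of_all _ fun _ => hη1 _)
  rw [kernelAverage_add k η hr.ne', kernelAverage,
    ← integral_sub (hbdd (hk.integrable.comp_add_right _)) (hbdd hk.integrable)]
  calc ‖∫ z, (k (z + -(r⁻¹ • v)) * η (x + r • z) - k z * η (x + r • z)) ∂μ‖ₑ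
      ≤ ∫⁻ z, ‖k (z + -(r⁻¹ • v)) * η (x + r • z) - k z * η (x + r • z)‖ₑ ∂μ :=
        enorm_integral_le_lintegral_enorm _
    _ ≤ ∫⁻ z, ‖k (z + -(r⁻¹ • v)) - k z‖ₑ ∂μ := by
        refine lintegral_mono fun z => enorm_le_iff_norm_le.2 ?_
        rw [← sub_mul, norm_mul]
        exact mul_le_of_le_one_right (norm_nonneg _) (hη1 _)
    _ ≤ ‖-(r⁻¹ • v)‖ₑ * ∫⁻ z, ‖fderiv ℝ k z‖ₑ ∂μ := lintegral_enorm_comp_add_sub_le hk.contDiff _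
    _ = (∫⁻ z, ‖fderiv ℝ k z‖ₑ ∂μ) / ENNReal.ofReal r * ‖v‖ₑ := by
        rw [enorm_neg, enorm_smul, enorm_inv hr.ne', Real.enorm_of_nonneg hr.le, div_eq_mul_inv]
        ring

theorem lipschitzWith_kernelAverage [FiniteDimensional ℝ V] [IsFiniteMeasureOnCompacts μ]
    (hk : IsAveragingKernel μ k) (hη : Continuous η) (hη1 : ∀ x, ‖η x‖ ≤ 1) {r : ℝ} (hr : 0 < r) :
    LipschitzWith ((∫⁻ z, ‖fderiv ℝ k z‖ₑ ∂μ).toNNReal / r.toNNReal) (kernelAverage μ k η r) := by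
  intro x y
  rw [ENNReal.coe_div (by simpa using hr), ENNReal.coe_toNNReal hk.lintegral_enorm_fderiv_ne_top,
    edist_comm x, edist_comm _ (kernelAverage μ k η r y), edist_eq_enorm_sub, edist_eq_enorm_sub]
  simpa [ENNReal.ofReal] using hk.enorm_kernelAverage_add_sub_le hη hη1 hr x (y - x)

end IsAveragingKernel

end Averages

theorem IsTransportPlan.ofReal_integral_sub_le {X : Type*} [MeasurableSpace X]
    [PseudoEMetricSpace X] {μ ν : Measure X} {γ : Measure (X × X)} (hγ : IsTransportPlan μ ν γ)
    {f : X → ℝ} {K : ℝ≥0} (hf : LipschitzWith K f) (hμ : Integrable f μ) (hν : Integrable f ν) :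
    ENNReal.ofReal (∫ x, f x ∂μ - ∫ x, f x ∂ν) ≤ K * ∫⁻ p, edist p.1 p.2 ∂γ := by
  obtain ⟨rfl, rfl⟩ := hγ
  have hfst : Integrable (fun p => f p.1) γ :=
    (integrable_map_measure hμ.1 measurable_fst.aemeasurable).1 hμ
  have hsnd : Integrable (fun p => f p.2) γ :=
    (integrable_map_measure hν.1 measurable_snd.aemeasurable).1 hν
  rw [integral_map measurable_fst.aemeasurable hμ.1, integral_map measurable_snd.aemeasurable hν.1,
    ← integral_sub hfst hsnd, ← lintegral_const_mul' _ _ ENNReal.coe_ne_top]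
  calc ENNReal.ofReal (∫ p, (f p.1 - f p.2) ∂γ)
      ≤ ‖∫ p, (f p.1 - f p.2) ∂γ‖ₑ := Real.ofReal_le_enorm _
    _ ≤ ∫⁻ p, ‖f p.1 - f p.2‖ₑ ∂γ := enorm_integral_le_lintegral_enorm _
    _ ≤ ∫⁻ p, K * edist p.1 p.2 ∂γ := lintegral_mono fun p => by
        simpa only [edist_eq_enorm_sub] using hf p.1 p.2

theorem integral_sub_le_mul_wassersteinOne {X : Type*} [MeasurableSpace X]
    [PseudoEMetricSpace X] {μ ν : Measure X} (hW : wassersteinOne μ ν ≠ ∞) {f : X → ℝ} {K : ℝ≥0}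
    (hf : LipschitzWith K f) (hμ : Integrable f μ) (hν : Integrable f ν) :
    ∫ x, f x ∂μ - ∫ x, f x ∂ν ≤ K * (wassersteinOne μ ν).toReal := by
  have hplan : Nonempty {γ // IsTransportPlan μ ν γ} := by
    by_contra h
    rw [not_nonempty_iff] at h
    exact hW (by rw [wassersteinOne, iInf_subtype', iInf_of_empty])
  have hle : ENNReal.ofReal (∫ x, f x ∂μ - ∫ x, f x ∂ν) ≤ K * wassersteinOne μ ν := by
    rw [wassersteinOne, iInf_subtype', ENNReal.mul_iInf fun h => absurd h ENNReal.coe_ne_top]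
    exact le_iInf fun γ => γ.2.ofReal_integral_sub_le hf hμ hν
  simpa using (ENNReal.ofReal_le_iff_le_toReal (ENNReal.mul_ne_top ENNReal.coe_ne_top hW)).1 hle

theorem measure_symmDiff_eq_zero_of_wassersteinOne_eq_zero {V : Type*} [NormedAddCommGroup V]
    [NormedSpace ℝ V] [FiniteDimensional ℝ V] [MeasurableSpace V] [BorelSpace V] {μ : Measure V}
    [IsFiniteMeasureOnCompacts μ] {E F : Set V} (hE : NullMeasurableSet E μ)
    (hF : NullMeasurableSet F μ) (hEv : μ E ≠ ∞) (hFv : μ F ≠ ∞)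
    (hW : wassersteinOne (μ.restrict E) (μ.restrict F) = 0) : μ (E ∆ F) = 0 := by
  have hreal : μ.real (E ∆ F) ≤ 0 := by
    refine measureReal_symmDiff_le_of_forall_isUnitTestFunction hE hF hEv hFv fun η hη => ?_
    obtain ⟨K, hK⟩ :=
      hη.contDiff.lipschitzWith_of_hasCompactSupport hη.hasCompactSupport one_ne_zero
    simpa [hW] using integral_sub_le_mul_wassersteinOne (hW.trans_ne ENNReal.zero_ne_top) hK
      hη.integrable.integrableOn hη.integrable.integrableOn
  exact (measureReal_eq_zero_iff (measure_symmDiff_ne_top hEv hFv)).1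
    (hreal.antisymm measureReal_nonneg)

section Perimeter

variable {d : ℕ} {E : Set (EuclideanSpace ℝ (Fin d))}

theorem divergence_smul_const {η : EuclideanSpace ℝ (Fin d) → ℝ} {x : EuclideanSpace ℝ (Fin d)}
    (hη : DifferentiableAt ℝ η x) (u : EuclideanSpace ℝ (Fin d)) :
    divergence (fun y => η y • u) x = fderiv ℝ η x u := by
  have hu : u = ∑ i, u i • EuclideanSpace.single i (1 : ℝ) := by
    simpa using ((EuclideanSpace.basisFun (Fin d) ℝ).sum_repr u).symm
  conv_rhs => rw [hu]
  simp [divergence, fderiv_smul_const hη, mul_comm]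

theorem ofReal_neg_setIntegral_divergence_le_perimeter
    {ξ : EuclideanSpace ℝ (Fin d) → EuclideanSpace ℝ (Fin d)} (hξ : ContDiff ℝ 1 ξ)
    (hc : HasCompactSupport ξ) (hξ1 : ∀ x, ‖ξ x‖ ≤ 1) :
    ENNReal.ofReal (-∫ x in E, divergence ξ x) ≤ perimeter E :=
  le_iSup_of_le ξ <| le_iSup_of_le hξ <| le_iSup_of_le hc <| le_iSup_of_le hξ1 le_rfl

variable {η : EuclideanSpace ℝ (Fin d) → ℝ}

theorem neg_setIntegral_fderiv_le_perimeter (hP : perimeter E ≠ ∞) (hη : IsUnitTestFunction η)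
    (v : EuclideanSpace ℝ (Fin d)) :
    -∫ x in E, fderiv ℝ η x v ≤ ‖v‖ * (perimeter E).toReal := by
  rcases eq_or_ne v 0 with rfl | hv
  · simp
  have hv' : 0 < ‖v‖ := norm_pos_iff.2 hv
  have hadmissible : ∀ x, ‖η x • ‖v‖⁻¹ • v‖ ≤ 1 := fun x => by
    rw [norm_smul, norm_smul, norm_inv, norm_norm, inv_mul_cancel₀ hv'.ne', mul_one]
    exact hη.norm_le_one x
  have hle := (ENNReal.ofReal_le_iff_le_toReal hP).1 <|
    ofReal_neg_setIntegral_divergence_le_perimeter (E := E) (ξ := fun x => η x • ‖v‖⁻¹ • v)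
      (hη.contDiff.smul contDiff_const) hη.hasCompactSupport.smul_right hadmissible
  simp only [divergence_smul_const (hη.contDiff.differentiable one_ne_zero).differentiableAt,
    map_smul, smul_eq_mul, integral_const_mul] at hle
  rwa [← mul_neg, inv_mul_le_iff₀ hv'] at hle

theorem setIntegral_sub_setIntegral_comp_add_le_perimeter (hE : volume E ≠ ∞)
    (hP : perimeter E ≠ ∞) (hη : IsUnitTestFunction η) (h : EuclideanSpace ℝ (Fin d)) :
    (∫ x in E, η x) - ∫ x in E, η (x + h) ≤ ‖h‖ * (perimeter E).toReal := by
  have := isFiniteMeasure_restrict.2 hE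
  have : IsFiniteMeasure (volume.restrict (Set.uIoc (0 : ℝ) 1)) :=
    Real.isFiniteMeasure_restrict_Ioc _ _
  have hcont := hη.contDiff.continuous_fderiv one_ne_zero
  obtain ⟨M, hM⟩ := (hη.hasCompactSupport.fderiv ℝ).exists_bound_of_continuous hcont
  have hprod : Integrable (Function.uncurry fun (t : ℝ) x => fderiv ℝ η (x + t • h) h)
      ((volume.restrict (Set.uIoc 0 1)).prod (volume.restrict E)) := by
    have hline : Continuous fun p : ℝ × EuclideanSpace ℝ (Fin d) => p.2 + p.1 • h := by fun_prop
    exact .of_bound ((hcont.comp hline).clm_apply continuous_const).aestronglyMeasurable (M * ‖h‖)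
      (ae_of_all _ fun p => (fderiv ℝ η (p.2 + p.1 • h)).le_of_opNorm_le (hM _) h)
  have hder : ∀ t : ℝ, -∫ x in E, fderiv ℝ η (x + t • h) h ≤ ‖h‖ * (perimeter E).toReal :=
    fun t => by
      simpa only [fderiv_comp_add_right] using
        neg_setIntegral_fderiv_le_perimeter hP (hη.comp_add_right (t • h)) h
  calc (∫ x in E, η x) - ∫ x in E, η (x + h)
      = -∫ x in E, (η (x + h) - η x) := by
        rw [integral_sub (hη.comp_add_right h).integrable.integrableOn
          hη.integrable.integrableOn, neg_sub]
    _ = ∫ t in (0 : ℝ)..1, -∫ x in E, fderiv ℝ η (x + t • h) h := by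
        simp only [sub_eq_integral_fderiv hη.contDiff]
        rw [← intervalIntegral_integral_swap hprod, intervalIntegral.integral_neg]
    _ ≤ ∫ _ in (0 : ℝ)..1, ‖h‖ * (perimeter E).toReal := by
        refine intervalIntegral.integral_mono zero_le_one ?_ (by simp) hder
        rw [intervalIntegrable_iff]
        exact hprod.integral_prod_left.neg
    _ = ‖h‖ * (perimeter E).toReal := by simp

theorem setIntegral_sub_setIntegral_kernelAverage_le_perimeter (hE : volume E ≠ ∞)
    (hP : perimeter E ≠ ∞) {k : EuclideanSpace ℝ (Fin d) → ℝ} (hk : IsAveragingKernel volume k)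
    (hη : IsUnitTestFunction η) {r : ℝ} (hr : 0 ≤ r) :
    (∫ x in E, η x) - ∫ x in E, kernelAverage volume k η r x ≤ r * (perimeter E).toReal := by
  have := isFiniteMeasure_restrict.2 hE
  have hprod : Integrable (Function.uncurry fun x z => k z * η (x + r • z))
      ((volume.restrict E).prod volume) :=
    (hk.integrable.comp_snd _).mul_bdd (c := 1)
      (hη.continuous.comp (by fun_prop)).aestronglyMeasurable
      (ae_of_all _ fun _ => hη.norm_le_one _)
  have hint : Integrable fun z => ∫ x in E, k z * η (x + r • z) := hprod.integral_prod_right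
  have htranslate : ∀ z, k z * (∫ x in E, η x) - ∫ x in E, k z * η (x + r • z) ≤
      k z * (r * (perimeter E).toReal) := fun z => by
    rw [integral_const_mul, ← mul_sub]
    rcases eq_or_ne (k z) 0 with hz | hz
    · simp [hz]
    have hz1 : ‖z‖ ≤ 1 := mem_closedBall_zero_iff.1 (hk.support_subset hz)
    gcongr
    · exact hk.nonneg z
    refine (setIntegral_sub_setIntegral_comp_add_le_perimeter hE hP hη (r • z)).trans ?_
    gcongr
    rw [norm_smul, Real.norm_of_nonneg hr]
    exact mul_le_of_le_one_right hr hz1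
  calc (∫ x in E, η x) - ∫ x in E, kernelAverage volume k η r x
      = ∫ z, (k z * (∫ x in E, η x) - ∫ x in E, k z * η (x + r • z)) := by
        simp only [kernelAverage]
        rw [integral_integral_swap hprod, integral_sub (hk.integrable.mul_const _) hint,
          integral_mul_const, hk.integral_eq_one, one_mul]
    _ ≤ ∫ z, k z * (r * (perimeter E).toReal) :=
        integral_mono ((hk.integrable.mul_const _).sub hint) (hk.integrable.mul_const _) htranslate
    _ = r * (perimeter E).toReal := by rw [integral_mul_const, hk.integral_eq_one, one_mul]

end Perimeter

theorem setIntegral_nonpos_of_perimeter_eq_zero {d : ℕ} (hd : 1 ≤ d)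
    {E : Set (EuclideanSpace ℝ (Fin d))} (hE : volume E ≠ ∞) (hP : perimeter E = 0)
    {η : EuclideanSpace ℝ (Fin d) → ℝ} (hη : IsUnitTestFunction η) : ∫ x in E, η x ≤ 0 := by
  have := isFiniteMeasure_restrict.2 hE
  have : Nonempty (Fin d) := ⟨⟨0, hd⟩⟩
  obtain ⟨e, he⟩ := exists_ne (0 : EuclideanSpace ℝ (Fin d))
  refine ge_of_tendsto' (tendsto_integral_comp_add_smul_atTop (μ := volume.restrict E)
    hη.continuous hη.norm_le_one hη.hasCompactSupport.is_zero_at_infty he) fun t => ?_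
  simpa [hP] using setIntegral_sub_setIntegral_comp_add_le_perimeter hE
    (hP.trans_ne ENNReal.zero_ne_top) hη (t • e)

theorem volume_eq_zero_of_perimeter_eq_zero {d : ℕ} (hd : 1 ≤ d)
    {E : Set (EuclideanSpace ℝ (Fin d))} (hE : NullMeasurableSet E) (hEv : volume E ≠ ∞)
    (hP : perimeter E = 0) : volume E = 0 := by
  have hreal : volume.real (E ∆ ⊥) ≤ 0 :=
    measureReal_symmDiff_le_of_forall_isUnitTestFunction hE nullMeasurableSet_empty hEv (by simp)
      fun η hη => by simpa using setIntegral_nonpos_of_perimeter_eq_zero hd hEv hP hη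
  rw [symmDiff_bot] at hreal
  exact (measureReal_eq_zero_iff hEv).1 (hreal.antisymm measureReal_nonneg)

theorem volume_symmDiff_eq_zero_of_perimeter_eq_zero {d : ℕ} (hd : 1 ≤ d)
    {E F : Set (EuclideanSpace ℝ (Fin d))} (hE : NullMeasurableSet E) (hF : NullMeasurableSet F)
    (hEv : volume E ≠ ∞) (hFv : volume F ≠ ∞) (hP : perimeter E + perimeter F = 0) :
    volume (E ∆ F) = 0 := by
  obtain ⟨hPE, hPF⟩ := add_eq_zero.1 hP
  exact measure_mono_null Set.symmDiff_subset_union (measure_union_null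
    (volume_eq_zero_of_perimeter_eq_zero hd hE hEv hPE)
    (volume_eq_zero_of_perimeter_eq_zero hd hF hFv hPF))

theorem measureReal_symmDiff_le_perimeter_add_wassersteinOne {d : ℕ}
    {k : EuclideanSpace ℝ (Fin d) → ℝ} (hk : IsAveragingKernel volume k)
    {E F : Set (EuclideanSpace ℝ (Fin d))} (hE : NullMeasurableSet E) (hF : NullMeasurableSet F)
    (hEv : volume E ≠ ∞) (hFv : volume F ≠ ∞) (hP : perimeter E + perimeter F ≠ ∞)
    (hW : wassersteinOne (volume.restrict E) (volume.restrict F) ≠ ∞) {r : ℝ} (hr : 0 < r) :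
    volume.real (E ∆ F) ≤ r * (perimeter E + perimeter F).toReal +
      (∫⁻ z, ‖fderiv ℝ k z‖ₑ).toNNReal / r *
        (wassersteinOne (volume.restrict E) (volume.restrict F)).toReal := by
  refine measureReal_symmDiff_le_of_forall_isUnitTestFunction hE hF hEv hFv fun η hη => ?_
  obtain ⟨hPE, hPF⟩ := ENNReal.add_ne_top.1 hP
  have hlip := hk.lipschitzWith_kernelAverage hη.continuous hη.norm_le_one hr
  have hint : ∀ {S : Set (EuclideanSpace ℝ (Fin d))}, volume S ≠ ∞ →
      IntegrableOn (kernelAverage volume k η r) S := fun hS =>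
    .of_bound hS.lt_top hlip.continuous.aestronglyMeasurable 1
      (ae_of_all _ (hk.norm_kernelAverage_le_one hη.norm_le_one r))
  have haverageE := setIntegral_sub_setIntegral_kernelAverage_le_perimeter hEv hPE hk hη hr.le
  have haverageF := setIntegral_sub_setIntegral_kernelAverage_le_perimeter hFv hPF hk hη.neg hr.le
  have htransport := integral_sub_le_mul_wassersteinOne hW hlip (hint hEv) (hint hFv)
  simp only [kernelAverage_neg, integral_neg] at haverageF
  rw [NNReal.coe_div, Real.coe_toNNReal r hr.le] at htransport
  rw [ENNReal.toReal_add hPE hPF]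
  linarith

theorem mainTheorem4_general (d : ℕ) (hd : 1 ≤ d) :
    ∃ C : ℝ≥0, ∀ E F : Set (EuclideanSpace ℝ (Fin d)),
      NullMeasurableSet E volume → NullMeasurableSet F volume → volume E ≠ ∞ → volume F ≠ ∞ →
      volume (E ∆ F) ≤
        C * (perimeter E + perimeter F) ^ (1 / 2 : ℝ) *
          wassersteinOne (volume.restrict E) (volume.restrict F) ^ (1 / 2 : ℝ) := by
  obtain ⟨k, hk⟩ := exists_isAveragingKernel (volume : Measure (EuclideanSpace ℝ (Fin d)))
  refine ⟨1 + (∫⁻ z, ‖fderiv ℝ k z‖ₑ).toNNReal, fun E F hE hF hEv hFv => ?_⟩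
  exact le_mul_rpow_half_mul_rpow_half (measure_symmDiff_ne_top hEv hFv)
    (volume_symmDiff_eq_zero_of_perimeter_eq_zero hd hE hF hEv hFv)
    (measure_symmDiff_eq_zero_of_wassersteinOne_eq_zero hE hF hEv hFv)
    fun hP hW r hr => measureReal_symmDiff_le_perimeter_add_wassersteinOne hk hE hF hEv hFv hP hW hr

theorem mainTheorem4 (d : ℕ) (hd : 1 ≤ d) :
    ∃ C : ℝ≥0, ∀ E F : Set (EuclideanSpace ℝ (Fin d)),
      HasFinitePerimeter E → HasFinitePerimeter F →
      ∫⁻ x in E ∪ F, ‖x‖ₑ ∂volume < ∞ →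
      volume (E ∆ F) ≤
        C * (perimeter E + perimeter F) ^ (1 / 2 : ℝ) *
          wassersteinOne (volume.restrict E) (volume.restrict F) ^ (1 / 2 : ℝ) := by
  obtain ⟨C, hC⟩ := mainTheorem4_general d hd
  refine ⟨C, fun E F hE hF hmoment => ?_⟩
  have hvolume := measure_lt_top_of_setLIntegral_enorm_lt_top hmoment
  exact hC E F hE.1 hF.1 (measure_ne_top_of_subset Set.subset_union_left hvolume.ne)
    (measure_ne_top_of_subset Set.subset_union_right hvolume.ne)
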